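/- For every $\varepsilon>0$ and every $c\in\mathbb N$ there are constants $B,K$ and a deterministic distributed algorithm for the CONGEST model with the following property. Let $G=(V,E)$ be any simple undirected graph on $n$ vertices (not necessarily connected), let $w:E\to[0,\infty)$ be edge weights, and let every edge be labelled positive or negative. Let $G$ also be the communication network: the nodes have distinct identifiers in $\{0,1,\dots,n^c\}$, communicate with their neighbours in synchronous rounds, and each node initially knows only $n$, its own identifier, its degree and, for each of its incident edges (numbered in an arbitrary way by local ports), the weight and the sign of that edge. Local computation is unrestricted. Then, when the algorithm is run on this network, 1. every message sent over an edge in any round has at most $B\log_2 n$ bits; 2. all nodes terminate after at most $K\log^* n$ rounds, where $\log^* n$ is the least $k\ge 0$ such that applying $\log_2$ to $n$ $k$ times gives a value at most $1$; 3. each node $v$ outputs a label $\ell(v)\in\mathbb N$, and the partition of $V$ into the clusters $\{v:\ell(v)=i\}$ is a $(1/2-\varepsilon)$-approximation for weighted max-agree correlation clustering: for every partition $C'$ of $V$, with any number of clusters, the total weight of the edges that agree with the output partition is at least $(1/2-\varepsilon)$ times the total weight of the edges that agree with $C'$. Here an edge agrees with a partition if it is positive and its endpoints lie in the same cluster, or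 negative and its endpoints lie in different clusters. -/

import Mathlib

/-- The iterated logarithm `log* n`: the least number of times the binary logarithm has to be
applied, starting from `n`, until the value is at most `1`. -/
noncomputable def logStar (n : ℕ) : ℕ :=
  sInf {k : ℕ | (Real.logb 2)^[k] (n : ℝ) ≤ 1}

/-! ### The CONGEST model -/

/-- What turns a graph `G` into a communication network: unique identifiers, and for each node `v`
a numbering of its incident edges by ports `0, …, deg v - 1`. Nodes do not initially know
which node sits behind a port. -/
structure CongestNetwork {V : Type} (G : SimpleGraph V) where
  /-- the unique identifier of a node -/
  ident : V → ℕ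
  ident_injective : Function.Injective ident
  /-- the degree of a node, forced by `port` to be its degree in `G` -/
  deg : V → ℕ
  /-- the neighbour behind a port -/
  port : (v : V) → Fin (deg v) ≃ G.neighborSet v

/-- A deterministic distributed message-passing algorithm. Every edge of the network carries an
input in `EIn` that both of its endpoints see; every node has to produce an output in `Out`. All
nodes run the same program and local computation is unrestricted, as usual in this model.
States of a node with `d` ports live in `State d`. -/
structure CongestAlgorithm (EIn Out : Type) where
  State : ℕ → Type
  /-- The initial state of a node, from the number `n` of nodes of the network, its own identifier,
  its degree, and the inputs of its incident edges, listed by port. -/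
  init : (n ident deg : ℕ) → (Fin deg → EIn) → State deg
  /-- The bit string a node sends in the next round through each port
  (sending nothing is sending the empty string). -/
  send : {d : ℕ} → State d → Fin d → List Bool
  /-- The new state, from the old one and the bit strings received through the ports. -/
  receive : {d : ℕ} → State d → (Fin d → List Bool) → State d
  /-- `some o` if the node has terminated with output `o`, `none` if it is still running. -/
  output : {d : ℕ} → State d → Option Out

namespace CongestAlgorithm

variable {EIn Out V : Type} {G : SimpleGraph V}

/-- The bit string that `v` sends through port `p` in the round that starts in the
configuration `s`. Terminated nodes do not send anything. -/
def message (A : CongestAlgorithm EIn Out) (N : CongestNetwork G)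
    (s : (v : V) → A.State (N.deg v)) (v : V) (p : Fin (N.deg v)) : List Bool :=
  if (A.output (s v)).isSome then [] else A.send (s v) p

/-- One synchronous round: `v` receives through port `p`, behind which the neighbour
`u = N.port v p` sits, what `u` sends through its port leading to `v`. Terminated nodes do not
change their state any more. -/
def round (A : CongestAlgorithm EIn Out) (N : CongestNetwork G)
    (s : (v : V) → A.State (N.deg v)) : (v : V) → A.State (N.deg v) :=
  fun v =>
    if (A.output (s v)).isSome then s v
    else A.receive (s v) fun p =>
      A.message N s (N.port v p) ((N.port (N.port v p)).symm ⟨v, (N.port v p).2.symm⟩)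

/-- The configuration after `t` rounds, when the edge `e` has the input `x e`. -/
def run [Fintype V] (A : CongestAlgorithm EIn Out) (N : CongestNetwork G) (x : Sym2 V → EIn) :
    ℕ → (v : V) → A.State (N.deg v)
  | 0 => fun v => A.init (Fintype.card V) (N.ident v) (N.deg v) fun p => x s(v, N.port v p)
  | t + 1 => A.round N (A.run N x t)

end CongestAlgorithm

/-! ### Weighted correlation clustering -/

/-- The sign of an edge. -/
inductive EdgeSign
  | pos
  | neg

/-- An instance of weighted correlation clustering: a graph with nonnegative edge weights, each
edge of which is positive or negative. (Values of `weight` and `sign` off the edges are never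
used.) -/
structure CorrelationInstance (V : Type) where
  graph : SimpleGraph V
  weight : Sym2 V → ℝ
  weight_nonneg : ∀ e ∈ graph.edgeSet, 0 ≤ weight e
  sign : Sym2 V → EdgeSign

namespace CorrelationInstance

variable {V : Type}

/-- The edge `e` agrees with the partition of the vertices into the classes of `C`: it is
positive with both endpoints in the same cluster, or negative with endpoints in different
clusters. -/
def Agrees (I : CorrelationInstance V) (C : Setoid V) (e : Sym2 V) : Prop :=
  (I.sign e = EdgeSign.pos ∧ ∀ u ∈ e, ∀ v ∈ e, C u v) ∨
    (I.sign e = EdgeSign.neg ∧ ∃ u ∈ e, ∃ v ∈ e, ¬ C u v)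

open Classical in
/-- The total weight of the edges that agree with the partition `C`. -/
noncomputable def agreements [Fintype V] (I : CorrelationInstance V) (C : Setoid V) : ℝ :=
  ∑ e : Sym2 V, if e ∈ I.graph.edgeSet ∧ I.Agrees C e then I.weight e else 0

/-- `C` is a `ρ`-approximation for max-agree: its agreements are at least `ρ` times those of every
partition, with any number of clusters. -/
def IsMaxAgreeApprox [Fintype V] (I : CorrelationInstance V) (ρ : ℝ) (C : Setoid V) : Prop :=
  ∀ C' : Setoid V, ρ * I.agreements C' ≤ I.agreements C

/-- The input of an edge, known to both endpoints: its weight and its sign. -/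
def edgeInput (I : CorrelationInstance V) (e : Sym2 V) : ℝ × EdgeSign :=
  (I.weight e, I.sign e)

end CorrelationInstance

/-! ### The iterated logarithm -/

/-! Two clusters suffice, and the comparison is with the total weight of all edges, which bounds the
agreements of any partition. Suppose the nodes carry a colouring in which at most a fraction `δ` of
the weight at each node lies on monochromatic edges. Let the colour classes choose a side one after
the other, each node taking the side that agrees with at least half of the weight towards smaller
colours. Then at least half of the bichromatic weight agrees, hence at least `(1 - δ) / 2` of the
total (`isMaxAgreeApprox_of_greedy`).

What remains is to find such a colouring with `δ = 2⁻ʳ` and a constant number of colours in `log* n`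
rounds. The identifiers form a proper colouring. A recolouring step reads an `L`-bit colour as a
polynomial over a prime field with `q` elements; distinct colours agree at no more than `L` points,
so by averaging each node finds a point `x` where only a fraction `L / q` of its weight collides.
The new colour is the pair of `x` and the value at `x`, of `O(log L)` bits. Neighbours with equal
pairs chose the same `x`, so each node's own choice controls all its new conflicts.

The invariant is a monochromatic fraction of at most `1 / (2 ^ r * L)` (`clusterValue_recoloring`).
A step adds at most that much again, and since it is made only if it at least halves `L`, the
invariant survives (`recolor_defect_le`). Once no halving is possible, `L` is already bounded
(`colorBits_logStar_le`). -/

theorem exists_iterate_logb_le_one (m : ℕ) :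
    ∀ x : ℝ, x ≤ m + 1 → ∃ k : ℕ, (Real.logb 2)^[k] x ≤ 1 := by
  induction m with
  | zero => exact fun x hx => ⟨0, by simpa using hx⟩
  | succ m ih =>
    intro x hx
    by_cases h1 : x ≤ 1
    · exact ⟨0, h1⟩
    · push Not at h1
      have hpow : x ≤ (2 : ℝ) ^ ((m + 1 : ℕ) : ℝ) := by
        rw [Real.rpow_natCast]
        refine hx.trans ?_
        exact_mod_cast Nat.lt_two_pow_self (n := m + 1)
      have hlog : Real.logb 2 x ≤ m + 1 := by
        have := (Real.logb_le_iff_le_rpow one_lt_two (by linarith)).2 hpow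
        exact_mod_cast this
      obtain ⟨k, hk⟩ := ih _ hlog
      exact ⟨k + 1, hk⟩

theorem iterate_logb_logStar_le_one (n : ℕ) : (Real.logb 2)^[logStar n] (n : ℝ) ≤ 1 :=
  Nat.sInf_mem (s := {k : ℕ | (Real.logb 2)^[k] (n : ℝ) ≤ 1})
    (exists_iterate_logb_le_one n n (by linarith))

/-- This lets the constant number of greedy rounds be absorbed into a multiple of `log* n`. -/
theorem one_le_logStar {n : ℕ} (hn : 2 ≤ n) : 1 ≤ logStar n := by
  by_contra! h
  have h0 : logStar n = 0 := by omega
  have := iterate_logb_logStar_le_one n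
  rw [h0] at this
  have h2 : (2 : ℝ) ≤ n := by exact_mod_cast hn
  simp only [Function.iterate_zero, id_eq] at this
  linarith

theorem Nat.clog_two_le_logb_add_one {m : ℕ} (hm : 1 ≤ m) :
    (Nat.clog 2 m : ℝ) ≤ Real.logb 2 m + 1 := by
  rcases hm.eq_or_lt with rfl | h
  · simp
  · have h1 := Nat.pow_pred_clog_lt_self one_lt_two h
    have hpos := Nat.clog_pos one_lt_two h
    have h2 : ((2 : ℝ) ^ (((Nat.clog 2 m).pred : ℕ) : ℝ)) ≤ m := by
      rw [Real.rpow_natCast]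
      exact_mod_cast h1.le
    have h3 := (Real.le_logb_iff_rpow_le one_lt_two (by positivity)).2 h2
    have h4 : (Nat.clog 2 m : ℝ) = ((Nat.clog 2 m).pred : ℕ) + 1 := by
      exact_mod_cast (Nat.succ_pred_eq_of_pos hpos).symm
    linarith

/-! ### The number of bits of the colours -/

/-- The number of bits of a colour after a recolouring step with accuracy `r`. -/
def recolorBits (r L : ℕ) : ℕ := 2 * (2 * Nat.clog 2 L + r) + 2

/-- The number of bits of the colours after `t` steps, each of which recolours only if that at
least halves the number of bits. -/
def colorBits (r L₀ : ℕ) : ℕ → ℕ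
  | 0 => L₀
  | t + 1 =>
    if 2 * recolorBits r (colorBits r L₀ t) ≤ colorBits r L₀ t then
      recolorBits r (colorBits r L₀ t)
    else colorBits r L₀ t

theorem colorBits_pos {r L₀ : ℕ} (h : 1 ≤ L₀) (t : ℕ) : 1 ≤ colorBits r L₀ t := by
  induction t with
  | zero => exact h
  | succ t ih =>
    rw [colorBits]
    split_ifs
    · unfold recolorBits; omega
    · exact ih

theorem colorBits_le (r L₀ t : ℕ) : colorBits r L₀ t ≤ L₀ := by
  induction t with
  | zero => exact le_rfl
  | succ t ih =>
    rw [colorBits]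
    split_ifs <;> omega

/-- The factor 2 covers a skipped step: skipping means that the old length is already below this
bound. -/
theorem colorBits_succ_le (r L₀ t : ℕ) :
    colorBits r L₀ (t + 1) ≤ 2 * recolorBits r (colorBits r L₀ t) := by
  rw [colorBits]
  split_ifs <;> omega

/-- A step replaces the length by at most `8 * clog L + 4 * r + 4`, so inductively by `8 * j + 4 * r
+ 12` plus `8` times the next iterated logarithm; `hj` puts this under the same factor `2 ^ j`. The
maximum with `1` also neutralises logarithms of nonpositive numbers. -/
theorem colorBits_le_iterate_logb {r c j n : ℕ} (hn : 1 ≤ n) (hc : c + 1 ≤ 2 ^ j)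
    (hj : 8 * j + 4 * r + 20 ≤ 2 ^ j) (t : ℕ) :
    (colorBits r (c * Nat.clog 2 n + 1) t : ℝ) ≤
      2 ^ j * max ((Real.logb 2)^[t] (n : ℝ)) 1 := by
  induction t with
  | zero =>
    have h1 : c * Nat.clog 2 n + 1 ≤ (c + 1) * n := by
      have := Nat.clog_le_of_le_pow (b := 2) (x := n) (y := n) Nat.lt_two_pow_self.le
      nlinarith
    have h2 : (((c * Nat.clog 2 n + 1 : ℕ)) : ℝ) ≤ 2 ^ j * n := by
      exact_mod_cast h1.trans (Nat.mul_le_mul_right _ hc)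
    refine h2.trans ?_
    gcongr
    exact le_max_left _ _
  | succ t ih =>
    set L := colorBits r (c * Nat.clog 2 n + 1) t with hL
    set y := (Real.logb 2)^[t] (n : ℝ) with hy
    have hL1 : 1 ≤ L := colorBits_pos (by omega) t
    have hlogL : Real.logb 2 L ≤ j + Real.logb 2 (max y 1) := by
      have h1 : Real.logb 2 L ≤ Real.logb 2 (2 ^ j * max y 1) :=
        Real.logb_le_logb_of_le one_lt_two (by positivity) ih
      rwa [Real.logb_mul (by positivity) (by positivity), Real.logb_pow,
        Real.logb_self_eq_one one_lt_two, mul_one] at h1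
    have hmax : Real.logb 2 (max y 1) ≤ max (Real.logb 2 y) 1 := by
      rcases le_total y 1 with h | h
      · simp [max_eq_right h]
      · rw [max_eq_left h]
        exact le_max_left _ _
    have hclog := Nat.clog_two_le_logb_add_one hL1
    have hstep : (colorBits r (c * Nat.clog 2 n + 1) (t + 1) : ℝ) ≤
        8 * Nat.clog 2 L + 4 * r + 4 := by
      have := colorBits_succ_le r (c * Nat.clog 2 n + 1) t
      rw [← hL, recolorBits] at this
      have h' : colorBits r (c * Nat.clog 2 n + 1) (t + 1) ≤ 8 * Nat.clog 2 L + 4 * r + 4 := by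
        omega
      exact_mod_cast h'
    have hjr : (8 * j + 4 * r + 20 : ℝ) ≤ 2 ^ j := by exact_mod_cast hj
    rw [Function.iterate_succ_apply', ← hy]
    have hm1 : (1 : ℝ) ≤ max (Real.logb 2 y) 1 := le_max_right _ _
    nlinarith

theorem colorBits_logStar_le {r c j n : ℕ} (hn : 1 ≤ n) (hc : c + 1 ≤ 2 ^ j)
    (hj : 8 * j + 4 * r + 20 ≤ 2 ^ j) :
    colorBits r (c * Nat.clog 2 n + 1) (logStar n) ≤ 2 ^ j := by
  have h := colorBits_le_iterate_logb hn hc hj (logStar n)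
  rw [max_eq_right (iterate_logb_logStar_le_one n), mul_one] at h
  exact_mod_cast h

theorem exists_colorBits_bound (r c : ℕ) :
    ∃ j : ℕ, c + 1 ≤ 2 ^ j ∧ 8 * j + 4 * r + 20 ≤ 2 ^ j := by
  refine ⟨r + c + 8, ?_⟩
  have h : r + c < 2 ^ (r + c) := Nat.lt_two_pow_self
  rw [pow_add]
  constructor <;> omega

/-! ### Hashing colours -/

open Polynomial in
/-- The polynomial whose coefficients are the `L` lowest binary digits of `a`. -/
noncomputable def binaryPolynomial (q L a : ℕ) : (ZMod q)[X] :=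
  ∑ i ∈ Finset.range L, C (if a.testBit i then 1 else 0) * X ^ i

theorem coeff_binaryPolynomial (q L a i : ℕ) :
    (binaryPolynomial q L a).coeff i = if i < L ∧ a.testBit i then 1 else 0 := by
  simp only [binaryPolynomial, Polynomial.finsetSum_coeff, Polynomial.coeff_C_mul,
    Polynomial.coeff_X_pow, mul_ite, mul_one, mul_zero, Finset.sum_ite_eq, Finset.mem_range]
  split_ifs <;> simp_all

theorem binaryPolynomial_ne {q L a b : ℕ} [Fact (1 < q)] (ha : a < 2 ^ L) (hb : b < 2 ^ L)
    (hab : a ≠ b) : binaryPolynomial q L a ≠ binaryPolynomial q L b := by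
  intro h
  refine hab (Nat.eq_of_testBit_eq fun i => ?_)
  by_cases hi : i < L
  · have := congrArg (fun p => Polynomial.coeff p i) h
    simp only [coeff_binaryPolynomial, hi, true_and] at this
    cases hai : a.testBit i <;> cases hbi : b.testBit i <;> simp_all
  · have hp : 2 ^ L ≤ 2 ^ i := Nat.pow_le_pow_right two_pos (by omega)
    rw [Nat.testBit_lt_two_pow (ha.trans_le hp), Nat.testBit_lt_two_pow (hb.trans_le hp)]

/-- The points of agreement are roots of the nonzero difference of the two polynomials, and are
distinct modulo `q`. -/
theorem card_eval_binaryPolynomial_eq_le {q L a b : ℕ} [Fact q.Prime] (ha : a < 2 ^ L)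
    (hb : b < 2 ^ L) (hab : a ≠ b) :
    ((Finset.range q).filter fun x : ℕ =>
      (binaryPolynomial q L a).eval (x : ZMod q) =
        (binaryPolynomial q L b).eval (x : ZMod q)).card ≤ L := by
  have : Fact (1 < q) := ⟨(Fact.out : q.Prime).one_lt⟩
  set P := binaryPolynomial q L a - binaryPolynomial q L b with hP
  have hP0 : P ≠ 0 := sub_ne_zero.2 (binaryPolynomial_ne ha hb hab)
  have hdeg : P.natDegree ≤ L := by
    rw [Polynomial.natDegree_le_iff_coeff_eq_zero]
    intro i hi
    simp [hP, coeff_binaryPolynomial, hi.not_gt]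
  refine le_trans ?_ ((Multiset.toFinset_card_le P.roots).trans ((P.card_roots').trans hdeg))
  refine Finset.card_le_card_of_injOn (fun x : ℕ => (x : ZMod q)) ?_ ?_
  · intro x hx
    simp only [Finset.coe_filter, Finset.mem_range, Set.mem_ofPred_eq] at hx
    simp only [Finset.mem_coe, Multiset.mem_toFinset, Polynomial.mem_roots hP0,
      Polynomial.IsRoot.def]
    simp [hP, hx.2]
  · intro x hx y hy hxy
    simp only [Finset.coe_filter, Finset.mem_range, Set.mem_ofPred_eq] at hx hy
    have := (ZMod.natCast_eq_natCast_iff' x y q).1 hxy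
    rwa [Nat.mod_eq_of_lt hx.1, Nat.mod_eq_of_lt hy.1] at this

theorem exists_hash_family (L s : ℕ) :
    ∃ (q : ℕ) (h : ℕ → ℕ → ℕ), 2 ^ s < q ∧ q ≤ 2 ^ (s + 1) ∧ (∀ x a, h x a < q) ∧
      ∀ a b, a < 2 ^ L → b < 2 ^ L → a ≠ b →
        ((Finset.range q).filter fun x => h x a = h x b).card ≤ L := by
  -- Bertrand's postulate keeps the modulus within a factor 2 of the desired size.
  obtain ⟨q, hq, h1, h2⟩ := Nat.exists_prime_lt_and_le_two_mul (2 ^ s) (by positivity)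
  have : Fact q.Prime := ⟨hq⟩
  have : NeZero q := ⟨hq.ne_zero⟩
  refine ⟨q, fun x a => ((binaryPolynomial q L a).eval (x : ZMod q)).val, h1,
    by rw [pow_succ]; omega, fun x a => ZMod.val_lt _, fun a b ha hb hab => ?_⟩
  simpa only [(ZMod.val_injective q).eq_iff] using card_eval_binaryPolynomial_eq_le ha hb hab

/-- Averaging over `x`: each port with a different colour contributes its weight for at most `L` of
the `q` values of `x`. -/
theorem exists_few_collisions {d q L : ℕ} {h : ℕ → ℕ → ℕ} (hq : 0 < q)
    (hh : ∀ a b, a < 2 ^ L → b < 2 ^ L → a ≠ b →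
      ((Finset.range q).filter fun x => h x a = h x b).card ≤ L)
    (w : Fin d → ℝ) (hw : ∀ p, 0 ≤ w p) (a : ℕ) (b : Fin d → ℕ) (ha : a < 2 ^ L)
    (hb : ∀ p, b p < 2 ^ L) :
    ∃ x, x < q ∧
      q * ∑ p, (if b p ≠ a ∧ h x (b p) = h x a then w p else 0) ≤ L * ∑ p, w p := by
  have hsum : ∑ x ∈ Finset.range q,
      (q * ∑ p, (if b p ≠ a ∧ h x (b p) = h x a then w p else 0)) ≤
      ∑ _x ∈ Finset.range q, (L * ∑ p, w p) := by
    rw [← Finset.mul_sum, Finset.sum_comm, Finset.sum_const, Finset.card_range, nsmul_eq_mul]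
    gcongr
    rw [Finset.mul_sum]
    refine Finset.sum_le_sum fun p _ => ?_
    by_cases hp : b p = a
    · simpa [hp] using mul_nonneg (Nat.cast_nonneg L) (hw p)
    · simp only [ne_eq, hp, not_false_eq_true, true_and]
      rw [← Finset.sum_filter, Finset.sum_const, nsmul_eq_mul]
      exact mul_le_mul_of_nonneg_right (by exact_mod_cast hh _ _ (hb p) ha hp) (hw p)
  obtain ⟨x, hx, hle⟩ :=
    Finset.exists_le_of_sum_le (Finset.nonempty_range_iff.2 hq.ne') hsum
  exact ⟨x, Finset.mem_range.1 hx, hle⟩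

/-! ### Broadcast algorithms -/

/-- The state of a node that broadcasts a value of type `S` in every round. -/
structure BroadcastState (EIn S : Type) (d : ℕ) where
  size : ℕ
  time : ℕ
  input : Fin d → EIn
  value : S

/-- The algorithm in which every node broadcasts, in each of `T n` rounds, its value, encoded by
`enc`, and updates it by `upd`, which sees the size of the network, the time, the own value, the
inputs of the incident edges and the values of the neighbours. -/
def broadcastAlgorithm {EIn S Out : Type} (enc : S → List Bool) (dec : List Bool → S)
    (T : ℕ → ℕ) (init : ℕ → S) (upd : ℕ → ℕ → S → (d : ℕ) → (Fin d → EIn) → (Fin d → S) → S)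
    (out : S → Out) : CongestAlgorithm EIn Out where
  State := BroadcastState EIn S
  init n ident _ x := ⟨n, 0, x, init ident⟩
  send s _ := enc s.value
  receive {d} s m :=
    ⟨s.size, s.time + 1, s.input, upd s.size s.time s.value d s.input fun p => dec (m p)⟩
  output s := if T s.size ≤ s.time then some (out s.value) else none

/-- The values of the nodes after `t` rounds of a broadcast algorithm. -/
def broadcastValue {EIn S V : Type} [Fintype V] {G : SimpleGraph V} (init : ℕ → S)
    (upd : ℕ → ℕ → S → (d : ℕ) → (Fin d → EIn) → (Fin d → S) → S)
    (N : CongestNetwork G) (x : Sym2 V → EIn) : ℕ → V → S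
  | 0 => fun v => init (N.ident v)
  | t + 1 => fun v =>
    upd (Fintype.card V) t (broadcastValue init upd N x t v) (N.deg v)
      (fun p => x s(v, N.port v p)) fun p => broadcastValue init upd N x t (N.port v p)

section Broadcast

variable {EIn S Out V : Type} [Fintype V] {G : SimpleGraph V} {enc : S → List Bool}
  {dec : List Bool → S} {T : ℕ → ℕ} {init : ℕ → S}
  {upd : ℕ → ℕ → S → (d : ℕ) → (Fin d → EIn) → (Fin d → S) → S} {out : S → Out}

/-- All clocks agree, so nobody halts before the last round and every received string decodes to the
neighbour's value. -/
theorem run_broadcastAlgorithm (hdec : Function.LeftInverse dec enc) (N : CongestNetwork G)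
    (x : Sym2 V → EIn) (t : ℕ) (ht : t ≤ T (Fintype.card V)) (v : V) :
    (broadcastAlgorithm enc dec T init upd out).run N x t v =
      (⟨Fintype.card V, t, fun p => x s(v, N.port v p), broadcastValue init upd N x t v⟩ :
        BroadcastState EIn S (N.deg v)) := by
  induction t generalizing v with
  | zero => rfl
  | succ t ih =>
    have ih' := fun v => ih (by omega) v
    have hlt : ¬ T (Fintype.card V) ≤ t := by omega
    have hout : ∀ v, ((broadcastAlgorithm enc dec T init upd out).output
        ((broadcastAlgorithm enc dec T init upd out).run N x t v)).isSome = false := by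
      intro v
      rw [ih' v]
      simp [broadcastAlgorithm, hlt]
    have hmsg : ∀ v p, (broadcastAlgorithm enc dec T init upd out).message N
        ((broadcastAlgorithm enc dec T init upd out).run N x t) v p =
        enc (broadcastValue init upd N x t v) := by
      intro v p
      rw [CongestAlgorithm.message, hout v, ih' v]
      rfl
    rw [CongestAlgorithm.run, CongestAlgorithm.round, hout v]
    simp only [hmsg, Bool.false_eq_true, if_false]
    rw [ih' v]
    simp only [broadcastAlgorithm, hdec _, broadcastValue]

theorem output_broadcastAlgorithm (hdec : Function.LeftInverse dec enc) (N : CongestNetwork G)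
    (x : Sym2 V → EIn) (v : V) :
    (broadcastAlgorithm enc dec T init upd out).output
      ((broadcastAlgorithm enc dec T init upd out).run N x (T (Fintype.card V)) v) =
      some (out (broadcastValue init upd N x (T (Fintype.card V)) v)) := by
  rw [run_broadcastAlgorithm hdec N x _ le_rfl v]
  simp [broadcastAlgorithm]

theorem run_broadcastAlgorithm_of_le (hdec : Function.LeftInverse dec enc)
    (N : CongestNetwork G) (x : Sym2 V → EIn) (t : ℕ) (ht : T (Fintype.card V) ≤ t) :
    (broadcastAlgorithm enc dec T init upd out).run N x t =
      (broadcastAlgorithm enc dec T init upd out).run N x (T (Fintype.card V)) := by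
  induction t, ht using Nat.le_induction with
  | base => rfl
  | succ t ht ih =>
    funext v
    rw [CongestAlgorithm.run, CongestAlgorithm.round, ih, output_broadcastAlgorithm hdec N x v]
    rfl

theorem message_broadcastAlgorithm (hdec : Function.LeftInverse dec enc)
    (N : CongestNetwork G) (x : Sym2 V → EIn) (t : ℕ) (v : V) (p : Fin (N.deg v)) :
    (broadcastAlgorithm enc dec T init upd out).message N
      ((broadcastAlgorithm enc dec T init upd out).run N x t) v p =
      if T (Fintype.card V) ≤ t then [] else enc (broadcastValue init upd N x t v) := by
  split_ifs with h
  · rw [CongestAlgorithm.message, run_broadcastAlgorithm_of_le hdec N x t h,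
      output_broadcastAlgorithm hdec N x v]
    rfl
  · rw [CongestAlgorithm.message, run_broadcastAlgorithm hdec N x t (by omega) v]
    simp [broadcastAlgorithm, h]

end Broadcast

/-! ### Agreements of a colouring with two clusters -/

/-- Whether two nodes on the sides `b` and `b'` agree with the sign of an edge between them. -/
def EdgeSign.agreesWith (σ : EdgeSign) (b b' : Bool) : Prop :=
  (σ = EdgeSign.pos ∧ b = b') ∨ (σ = EdgeSign.neg ∧ b ≠ b')

theorem EdgeSign.agreesWith_comm (σ : EdgeSign) (b b' : Bool) :
    σ.agreesWith b b' ↔ σ.agreesWith b' b := by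
  simp only [agreesWith, eq_comm, ne_comm]

open Classical in
-- Each edge agrees with exactly one of the two choices, so the better choice gets at least half.
theorem exists_side_agreement {d : ℕ} (w : Fin d → ℝ) (σ : Fin d → EdgeSign)
    (b : Fin d → Bool) (D : Fin d → Prop) [DecidablePred D] :
    ∃ c : Bool, ∑ p, (if D p then w p else 0) ≤
      2 * ∑ p, (if D p ∧ (σ p).agreesWith c (b p) then w p else 0) := by
  have hsum : ∑ p, (if D p then w p else 0) =
      ∑ p, (if D p ∧ (σ p).agreesWith false (b p) then w p else 0) +
        ∑ p, (if D p ∧ (σ p).agreesWith true (b p) then w p else 0) := by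
    rw [← Finset.sum_add_distrib]
    refine Finset.sum_congr rfl fun p _ => ?_
    by_cases hD : D p
    · cases hσ : σ p <;> cases hb : b p <;> simp [hD, EdgeSign.agreesWith]
    · simp [hD]
  rcases le_total (∑ p, (if D p ∧ (σ p).agreesWith false (b p) then w p else 0))
    (∑ p, (if D p ∧ (σ p).agreesWith true (b p) then w p else 0)) with h | h
  · exact ⟨true, by linarith⟩
  · exact ⟨false, by linarith⟩

theorem CongestNetwork.sum_port {V : Type} [Fintype V] {G : SimpleGraph V}
    (N : CongestNetwork G) (v : V) (f : V → ℝ) [DecidableRel G.Adj] :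
    ∑ p, f (N.port v p) = ∑ u, if G.Adj v u then f u else 0 := by
  rw [(N.port v).sum_comp (fun u : G.neighborSet v => f u), ← Finset.sum_filter]
  exact (Finset.sum_subtype _ (by simp) f).symm

open Classical in
theorem two_mul_sum_edgeSet {V : Type} [Fintype V] (G : SimpleGraph V) (f : Sym2 V → ℝ) :
    2 * ∑ e : Sym2 V, (if e ∈ G.edgeSet then f e else 0) =
      ∑ v, ∑ u, if G.Adj v u then f s(v, u) else 0 := by
  rw [← Fintype.sum_prod_type' (f := fun v u => if G.Adj v u then f s(v, u) else 0),
    Finset.mul_sum]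
  rw [← Finset.sum_fiberwise Finset.univ (fun x : V × V => s(x.1, x.2))]
  refine Finset.sum_congr rfl fun e _ => ?_
  induction e using Sym2.inductionOn with
  | hf a b =>
    by_cases hab : G.Adj a b
    · have hfil : (Finset.univ.filter fun x : V × V => s(x.1, x.2) = s(a, b)) =
          {(a, b), (b, a)} := by
        ext ⟨x, y⟩
        simp
      rw [hfil, Finset.sum_pair (by simp [hab.ne])]
      simp [hab, hab.symm, Sym2.eq_swap (a := b) (b := a), two_mul]
    · rw [Finset.sum_eq_zero]
      · simp [hab]
      · rintro ⟨x, y⟩ hxy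
        simp only [Finset.mem_filter, Finset.mem_univ, true_and, Sym2.eq_iff] at hxy
        rcases hxy with ⟨rfl, rfl⟩ | ⟨rfl, rfl⟩
        · simp [hab]
        · simp [G.adj_comm x y, hab]

namespace CorrelationInstance

variable {V : Type}

theorem agrees_ker_mk (I : CorrelationInstance V) (σ : V → Bool) {u v : V} :
    I.Agrees (Setoid.ker fun v => (σ v).toNat) s(u, v) ↔
      (I.sign s(u, v)).agreesWith (σ u) (σ v) := by
  simp only [Agrees, EdgeSign.agreesWith, Sym2.mem_iff, Setoid.ker_def,
    forall_eq_or_imp, forall_eq, exists_eq_or_imp, exists_eq_left]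
  cases hu : σ u <;> cases hv : σ v <;> simp

theorem agreements_nonneg [Fintype V] (I : CorrelationInstance V) (C : Setoid V) :
    0 ≤ I.agreements C := by
  refine Finset.sum_nonneg fun e _ => ?_
  split_ifs with h
  exacts [I.weight_nonneg e h.1, le_rfl]

theorem IsMaxAgreeApprox.mono [Fintype V] {I : CorrelationInstance V} {ρ ρ' : ℝ} {C : Setoid V}
    (h : I.IsMaxAgreeApprox ρ C) (hρ : ρ' ≤ ρ) : I.IsMaxAgreeApprox ρ' C :=
  fun C' => (mul_le_mul_of_nonneg_right hρ (I.agreements_nonneg C')).trans (h C')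

theorem isMaxAgreeApprox_of_subsingleton [Fintype V] [Subsingleton V]
    (I : CorrelationInstance V) (ρ : ℝ) (C : Setoid V) : I.IsMaxAgreeApprox ρ C := by
  have h : ∀ C : Setoid V, I.agreements C = 0 := by
    refine fun C => Finset.sum_eq_zero fun e _ => if_neg fun he => ?_
    induction e using Sym2.inductionOn with
    | hf a b => exact he.1.ne (Subsingleton.elim a b)
  intro C'
  simp [h]

open Classical in
/-- A partition into two sides is a good approximation if the colouring `φ` has little weight on
monochromatic edges and every node chose the better side for its edges to the nodes of smaller
colour. -/
theorem isMaxAgreeApprox_of_greedy [Fintype V] (I : CorrelationInstance V) (N : CongestNetwork I.graph)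
    {δ : ℝ} (hδ : δ ≤ 1) (φ : V → ℕ) (σ : V → Bool)
    (hφ : ∀ v, ∑ p, (if φ (N.port v p) = φ v then I.weight s(v, N.port v p) else 0) ≤
      δ * ∑ p, I.weight s(v, N.port v p))
    (hσ : ∀ v, ∑ p, (if φ (N.port v p) < φ v then I.weight s(v, N.port v p) else 0) ≤
      2 * ∑ p, (if φ (N.port v p) < φ v ∧
        (I.sign s(v, N.port v p)).agreesWith (σ v) (σ (N.port v p))
        then I.weight s(v, N.port v p) else 0)) :
    I.IsMaxAgreeApprox ((1 - δ) / 2) (Setoid.ker fun v => (σ v).toNat) := by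
  have hw : ∀ u v, I.graph.Adj v u → 0 ≤ I.weight s(v, u) :=
    fun u v h => I.weight_nonneg _ h
  set a : V → V → ℝ := fun v u => if I.graph.Adj v u then I.weight s(v, u) else 0 with ha
  have ha0 : ∀ v u, 0 ≤ a v u := by
    intro v u
    simp only [ha]
    split_ifs with h
    exacts [hw _ _ h, le_rfl]
  have hasymm : ∀ v u, a v u = a u v := by
    intro v u
    simp only [ha, I.graph.adj_comm v u, Sym2.eq_swap (a := v)]
  have hport : ∀ (v : V) (P : V → Prop) [DecidablePred P],
      ∑ p, (if P (N.port v p) then I.weight s(v, N.port v p) else 0) =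
        ∑ u, if P u then a v u else 0 := by
    intro v P _
    rw [N.sum_port v (fun u => if P u then I.weight s(v, u) else 0)]
    refine Finset.sum_congr rfl fun u _ => ?_
    simp only [ha]
    split_ifs <;> rfl
  have hmono : ∑ v, ∑ u, (if φ u = φ v then a v u else 0) ≤ δ * ∑ v, ∑ u, a v u := by
    rw [Finset.mul_sum]
    refine Finset.sum_le_sum fun v _ => ?_
    have h := hφ v
    rw [hport v (fun u => φ u = φ v)] at h
    have h2 := hport v (fun _ => True)
    simp only [if_true] at h2
    rwa [h2] at h
  have hgreedy : ∑ v, ∑ u, (if φ u < φ v then a v u else 0) ≤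
      2 * ∑ v, ∑ u, (if φ u < φ v ∧ (I.sign s(v, u)).agreesWith (σ v) (σ u)
        then a v u else 0) := by
    rw [Finset.mul_sum]
    refine Finset.sum_le_sum fun v _ => ?_
    have h := hσ v
    rwa [hport v (fun u => φ u < φ v),
      hport v (fun u => φ u < φ v ∧ (I.sign s(v, u)).agreesWith (σ v) (σ u))] at h
  -- Sums run over ordered pairs; by symmetry the pairs with `φ v < φ u` contribute as much as those
  -- with `φ u < φ v`. This is applied to all edges and to the agreeing ones.
  have hsplit : ∀ (R : V → V → Prop) [∀ v u, Decidable (R v u)], (∀ v u, R v u ↔ R u v) →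
      ∑ v, ∑ u, (if R v u then a v u else 0) =
        ∑ v, ∑ u, (if φ u = φ v ∧ R v u then a v u else 0) +
          2 * ∑ v, ∑ u, (if φ u < φ v ∧ R v u then a v u else 0) := by
    intro R _ hR
    have hswap : ∑ v, ∑ u, (if φ v < φ u ∧ R v u then a v u else 0) =
        ∑ v, ∑ u, (if φ u < φ v ∧ R v u then a v u else 0) := by
      rw [Finset.sum_comm]
      refine Finset.sum_congr rfl fun v _ => Finset.sum_congr rfl fun u _ => ?_
      simp only [hasymm u v, hR u v]
    rw [two_mul]
    nth_rewrite 1 [← hswap]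
    simp only [← Finset.sum_add_distrib]
    refine Finset.sum_congr rfl fun v _ => Finset.sum_congr rfl fun u _ => ?_
    by_cases h : R v u
    · rcases lt_trichotomy (φ u) (φ v) with h1 | h1 | h1
      · simp [h, h1, h1.ne, h1.not_gt]
      · simp [h, h1]
      · simp [h, h1, h1.ne', h1.not_gt]
    · simp [h]
  have htot := hsplit (fun _ _ => True) (by simp)
  have hagr := hsplit (fun v u => (I.sign s(v, u)).agreesWith (σ v) (σ u)) (by
    intro v u
    rw [EdgeSign.agreesWith_comm, Sym2.eq_swap])
  simp only [and_true, if_true] at htot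
  have hmn : 0 ≤ ∑ v, ∑ u, (if φ u = φ v ∧ (I.sign s(v, u)).agreesWith (σ v) (σ u)
      then a v u else 0) := by
    refine Finset.sum_nonneg fun v _ => Finset.sum_nonneg fun u _ => ?_
    split_ifs
    exacts [ha0 v u, le_rfl]
  have hagrees : ∀ C : Setoid V, 2 * I.agreements C =
      ∑ v, ∑ u, (if I.Agrees C s(v, u) then a v u else 0) := by
    intro C
    have h := two_mul_sum_edgeSet I.graph (fun e => if I.Agrees C e then I.weight e else 0)
    simp only [← ite_and] at h
    rw [agreements, h]
    refine Finset.sum_congr rfl fun v _ => Finset.sum_congr rfl fun u _ => ?_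
    by_cases h1 : I.graph.Adj v u <;> by_cases h2 : I.Agrees C s(v, u) <;> simp [ha, h1, h2]
  intro C'
  have hC := hagrees (Setoid.ker fun v => (σ v).toNat)
  simp only [agrees_ker_mk] at hC
  have hC' : 2 * I.agreements C' ≤ ∑ v, ∑ u, a v u := by
    rw [hagrees]
    refine Finset.sum_le_sum fun v _ => Finset.sum_le_sum fun u _ => ?_
    split_ifs
    exacts [le_rfl, ha0 v u]
  have := mul_le_mul_of_nonneg_left hC' (sub_nonneg.2 hδ)
  linarith

end CorrelationInstance

/-! ### The clustering algorithm -/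

/-- The size of the hash values in a recolouring step. -/
noncomputable def hashModulus (L s : ℕ) : ℕ := (exists_hash_family L s).choose

/-- The hash functions of a recolouring step. -/
noncomputable def colorHash (L s : ℕ) : ℕ → ℕ → ℕ :=
  (exists_hash_family L s).choose_spec.choose

theorem colorHash_spec (L s : ℕ) :
    2 ^ s < hashModulus L s ∧ hashModulus L s ≤ 2 ^ (s + 1) ∧
      (∀ x a, colorHash L s x a < hashModulus L s) ∧
      ∀ a b, a < 2 ^ L → b < 2 ^ L → a ≠ b →
        ((Finset.range (hashModulus L s)).filter fun x =>
          colorHash L s x a = colorHash L s x b).card ≤ L :=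
  (exists_hash_family L s).choose_spec.choose_spec

/-- The index of a hash function for which a node of colour `a` has little weight on the edges to
neighbours of another colour with the same hash value. -/
noncomputable def hashIndex {d : ℕ} (L s a : ℕ) (w : Fin d → ℝ) (b : Fin d → ℕ) : ℕ :=
  Classical.epsilon fun x => x < hashModulus L s ∧
    hashModulus L s * ∑ p, (if b p ≠ a ∧ colorHash L s x (b p) = colorHash L s x a
      then w p else 0) ≤ L * ∑ p, w p

/-- The new colour of a node of colour `a` with neighbours of colours `b`. -/
noncomputable def recolor {d : ℕ} (r L a : ℕ) (w : Fin d → ℝ) (b : Fin d → ℕ) : ℕ :=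
  if 2 * recolorBits r L ≤ L then
    hashIndex L (2 * Nat.clog 2 L + r) a w b + hashModulus L (2 * Nat.clog 2 L + r) *
      colorHash L (2 * Nat.clog 2 L + r) (hashIndex L (2 * Nat.clog 2 L + r) a w b) a
  else a

open Classical in
/-- The side that a node chooses, given the sides of some of its neighbours. -/
noncomputable def greedySide {d : ℕ} (w : Fin d → ℝ) (σ : Fin d → EdgeSign)
    (b : Fin d → ℕ ⊕ Bool) : Bool :=
  Classical.epsilon fun c => ∑ p, (if (b p).isRight then w p else 0) ≤
    2 * ∑ p, (if (b p).isRight ∧ (σ p).agreesWith c ((b p).elim (fun _ => false) id)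
      then w p else 0)

/-- The update of a node, whose value is its colour as long as it is undecided, and then its side.
After `logStar n` recolouring rounds the colour classes choose their sides one after the other. -/
noncomputable def clusterUpdate (r c n t : ℕ) (x : ℕ ⊕ Bool) (d : ℕ)
    (e : Fin d → ℝ × EdgeSign) (y : Fin d → ℕ ⊕ Bool) : ℕ ⊕ Bool :=
  x.elim
    (fun a =>
      if t < logStar n then
        Sum.inl (recolor r (colorBits r (c * Nat.clog 2 n + 1) t) a (fun p => (e p).1)
          fun p => (y p).elim id fun _ => 0)
      else if a = t - logStar n then
        Sum.inr (greedySide (fun p => (e p).1) (fun p => (e p).2) y)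
      else Sum.inl a)
    Sum.inr

/-- The encoding of the messages. -/
def encodeValue : ℕ ⊕ Bool → List Bool
  | Sum.inl a => true :: a.bits
  | Sum.inr b => [false, b]

theorem encodeValue_injective : Function.Injective encodeValue := by
  have hbits : Function.LeftInverse (fun l : List Bool => l.foldr Nat.bit 0) Nat.bits := by
    intro n
    induction n using Nat.binaryRec' with
    | zero => simp
    | bit b n h ih => simpa [Nat.bits_append_bit n b h] using congrArg (Nat.bit b) ih
  rintro (a | a) (b | b) h
  · simp only [encodeValue, List.cons.injEq, true_and] at h
    rw [hbits.injective h]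
  · simp [encodeValue] at h
  · simp [encodeValue] at h
  · simpa [encodeValue] using h

theorem length_encodeValue_inl_le {a L : ℕ} (ha : a < 2 ^ L) :
    (encodeValue (Sum.inl a)).length ≤ L + 1 := by
  simpa [encodeValue, ← Nat.size_eq_bits_len] using Nat.size_le.2 ha

theorem hashIndex_spec {d L s a : ℕ} {w : Fin d → ℝ} {b : Fin d → ℕ} (hw : ∀ p, 0 ≤ w p)
    (ha : a < 2 ^ L) (hb : ∀ p, b p < 2 ^ L) :
    hashIndex L s a w b < hashModulus L s ∧
      hashModulus L s * ∑ p, (if b p ≠ a ∧ colorHash L s (hashIndex L s a w b) (b p) =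
        colorHash L s (hashIndex L s a w b) a then w p else 0) ≤ L * ∑ p, w p := by
  obtain ⟨h1, -, -, h4⟩ := colorHash_spec L s
  exact Classical.epsilon_spec (exists_few_collisions (Nat.zero_lt_of_lt h1) h4 w hw a b ha hb)

theorem recolor_lt {d r L a : ℕ} {w : Fin d → ℝ} {b : Fin d → ℕ} (hw : ∀ p, 0 ≤ w p)
    (ha : a < 2 ^ L) (hb : ∀ p, b p < 2 ^ L) (h : 2 * recolorBits r L ≤ L) :
    recolor r L a w b < 2 ^ recolorBits r L := by
  obtain ⟨-, h2, h3, -⟩ := colorHash_spec L (2 * Nat.clog 2 L + r)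
  have hx := (hashIndex_spec (s := 2 * Nat.clog 2 L + r) hw ha hb).1
  rw [recolor, if_pos h]
  set q := hashModulus L (2 * Nat.clog 2 L + r)
  set x := hashIndex L (2 * Nat.clog 2 L + r) a w b
  have h3 := h3 x a
  -- Point and hash value are each below the modulus, hence take at most `2 * clog L + r + 1` bits
  -- each.
  have hpow : 2 ^ recolorBits r L =
      2 ^ (2 * Nat.clog 2 L + r + 1) * 2 ^ (2 * Nat.clog 2 L + r + 1) := by
    rw [← pow_add, recolorBits]
    congr 1
    ring
  rw [hpow]
  refine lt_of_lt_of_le ?_ (Nat.mul_le_mul h2 h2)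
  nlinarith

theorem Nat.eq_and_eq_of_add_mul_eq {q x x' y y' : ℕ} (hx : x < q) (hx' : x' < q)
    (h : x + q * y = x' + q * y') : x = x' ∧ y = y' := by
  have h1 : x = x' := by
    have := congrArg (· % q) h
    simpa [Nat.mod_eq_of_lt hx, Nat.mod_eq_of_lt hx'] using this
  subst h1
  exact ⟨rfl, Nat.eq_of_mul_eq_mul_left (by omega) (Nat.add_left_cancel h)⟩

theorem CorrelationInstance.weight_port_nonneg {V : Type} (I : CorrelationInstance V)
    (N : CongestNetwork I.graph) (v : V) (p : Fin (N.deg v)) :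
    0 ≤ I.weight s(v, N.port v p) :=
  I.weight_nonneg _ (N.port v p).2

/-- An edge that is monochromatic afterwards either was so before (weight `m`) or is a hash
collision at the point chosen by `v` (weight `k`). Both are at most `W / (2 ^ r * L)`, and halving
the length pays for the sum. -/
theorem recolor_defect_le {V : Type} (I : CorrelationInstance V) (N : CongestNetwork I.graph)
    {r L : ℕ} (hL : 1 ≤ L) (h : 2 * recolorBits r L ≤ L) (φ : V → ℕ)
    (hφ : ∀ v, φ v < 2 ^ L) (φ' : V → ℕ)
    (hφ' : ∀ v, φ' v = recolor r L (φ v) (fun p => I.weight s(v, N.port v p))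
      fun p => φ (N.port v p)) (v : V)
    (hdef : 2 ^ r * L * ∑ p, (if φ (N.port v p) = φ v then I.weight s(v, N.port v p) else 0) ≤
      ∑ p, I.weight s(v, N.port v p)) :
    2 ^ r * recolorBits r L *
      ∑ p, (if φ' (N.port v p) = φ' v then I.weight s(v, N.port v p) else 0) ≤
        ∑ p, I.weight s(v, N.port v p) := by
  have hw := I.weight_port_nonneg N
  set s := 2 * Nat.clog 2 L + r with hs
  obtain ⟨hq, -, -, -⟩ := colorHash_spec L s
  have hspec := fun v => hashIndex_spec (s := s) (hw v) (hφ v) fun p => hφ (N.port v p)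
  set x : V → ℕ := fun v => hashIndex L s (φ v) (fun p => I.weight s(v, N.port v p))
    fun p => φ (N.port v p) with hx
  set q := hashModulus L s with hqdef
  have hval : ∀ v, φ' v = x v + q * colorHash L s (x v) (φ v) := by
    intro v
    rw [hφ' v, recolor, if_pos h]
  set m := ∑ p, (if φ (N.port v p) = φ v then I.weight s(v, N.port v p) else 0)
  set W := ∑ p, I.weight s(v, N.port v p)
  set k := ∑ p, (if φ (N.port v p) ≠ φ v ∧ colorHash L s (x v) (φ (N.port v p)) =
    colorHash L s (x v) (φ v) then I.weight s(v, N.port v p) else 0) with hk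
  have hk0 : 0 ≤ k := Finset.sum_nonneg fun p _ => by
    split_ifs
    exacts [hw v p, le_rfl]
  have hqk : q * k ≤ L * W := (hspec v).2
  have hm' : ∑ p, (if φ' (N.port v p) = φ' v then I.weight s(v, N.port v p) else 0) ≤ m + k := by
    rw [hk, ← Finset.sum_add_distrib]
    refine Finset.sum_le_sum fun p _ => ?_
    by_cases he : φ' (N.port v p) = φ' v
    · rw [if_pos he]
      by_cases he' : φ (N.port v p) = φ v
      · simp [he']
      · rw [hval, hval] at he
        obtain ⟨h1, h2⟩ := Nat.eq_and_eq_of_add_mul_eq (hspec _).1 (hspec _).1 he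
        have h1' : x (N.port v p) = x v := h1
        have h2' : colorHash L s (x v) (φ (N.port v p)) = colorHash L s (x v) (φ v) := by
          rw [← h2, h1']
        simp [he', h2']
    · rw [if_neg he]
      refine add_nonneg ?_ ?_ <;> split_ifs <;> first | exact hw v p | exact le_rfl
  -- The choice of `s` serves this: it turns the collision fraction `L / q` into at most `1 / (2 ^ r
  -- * L)`.
  have hqL : L * (2 ^ r * L) ≤ q := by
    have hclog : L ≤ 2 ^ Nat.clog 2 L := Nat.le_pow_clog one_lt_two L
    calc L * (2 ^ r * L) ≤ 2 ^ Nat.clog 2 L * (2 ^ r * 2 ^ Nat.clog 2 L) := by gcongr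
      _ = 2 ^ s := by rw [hs]; ring
      _ ≤ q := hq.le
  have hqL' : (L : ℝ) * (2 ^ r * L) ≤ q := by exact_mod_cast hqL
  have hL0 : (0 : ℝ) < L := by exact_mod_cast hL
  have hkW : 2 ^ r * L * k ≤ W := by
    refine le_of_mul_le_mul_left ?_ hL0
    calc (L : ℝ) * (2 ^ r * L * k) = L * (2 ^ r * L) * k := by ring
      _ ≤ q * k := by gcongr
      _ ≤ L * W := hqk
  have h' : (2 * recolorBits r L : ℝ) ≤ L := by exact_mod_cast h
  have hmk : 0 ≤ m + k := add_nonneg (Finset.sum_nonneg fun p _ => by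
    split_ifs
    exacts [hw v p, le_rfl]) hk0
  have key : 2 ^ r * (2 * recolorBits r L) * (m + k) ≤ 2 * W := by
    calc (2 ^ r * (2 * recolorBits r L) * (m + k) : ℝ) ≤ 2 ^ r * L * (m + k) := by gcongr
      _ ≤ 2 * W := by linarith
  calc (2 ^ r * recolorBits r L *
      ∑ p, (if φ' (N.port v p) = φ' v then I.weight s(v, N.port v p) else 0) : ℝ)
      ≤ 2 ^ r * recolorBits r L * (m + k) := by gcongr
    _ ≤ W := by linarith

section Execution

variable {V : Type} [Fintype V] (I : CorrelationInstance V) (N : CongestNetwork I.graph)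

/-- The values of the nodes during the execution of the clustering algorithm. -/
noncomputable abbrev clusterValue (r c : ℕ) : ℕ → V → ℕ ⊕ Bool :=
  broadcastValue Sum.inl (clusterUpdate r c) N I.edgeInput

theorem clusterValue_succ (r c t : ℕ) (v : V) :
    clusterValue I N r c (t + 1) v =
      clusterUpdate r c (Fintype.card V) t (clusterValue I N r c t v) (N.deg v)
        (fun p => I.edgeInput s(v, N.port v p)) fun p => clusterValue I N r c t (N.port v p) :=
  rfl

theorem clusterValue_recoloring {r c : ℕ} (hN : ∀ v, N.ident v ≤ Fintype.card V ^ c) (t : ℕ)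
    (ht : t ≤ logStar (Fintype.card V)) :
    ∃ φ : V → ℕ, (∀ v, clusterValue I N r c t v = Sum.inl (φ v)) ∧
      (∀ v, φ v < 2 ^ colorBits r (c * Nat.clog 2 (Fintype.card V) + 1) t) ∧
      ∀ v, 2 ^ r * colorBits r (c * Nat.clog 2 (Fintype.card V) + 1) t *
        ∑ p, (if φ (N.port v p) = φ v then I.weight s(v, N.port v p) else 0) ≤
          ∑ p, I.weight s(v, N.port v p) := by
  induction t with
  | zero =>
    -- Distinct identifiers leave no monochromatic edge. The extra bit in the initial length is
    -- there because an identifier may equal `n ^ c`.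
    refine ⟨N.ident, fun v => rfl, fun v => (hN v).trans_lt ?_, fun v => ?_⟩
    · rw [colorBits]
      calc Fintype.card V ^ c ≤ (2 ^ Nat.clog 2 (Fintype.card V)) ^ c :=
            Nat.pow_le_pow_left (Nat.le_pow_clog one_lt_two _) c
        _ = 2 ^ (c * Nat.clog 2 (Fintype.card V)) := by rw [← pow_mul, mul_comm]
        _ < _ := Nat.pow_lt_pow_right one_lt_two (Nat.lt_succ_self _)
    · rw [Finset.sum_eq_zero fun p _ => if_neg fun h => ?_, mul_zero]
      · exact Finset.sum_nonneg fun p _ => I.weight_port_nonneg N v p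
      · exact I.graph.ne_of_adj (N.port v p).2 (N.ident_injective h).symm
  | succ t ih =>
    obtain ⟨φ, h1, h2, h3⟩ := ih (by omega)
    set L := colorBits r (c * Nat.clog 2 (Fintype.card V) + 1) t with hL
    have hL1 : 1 ≤ L := colorBits_pos (by omega) t
    refine ⟨fun v => recolor r L (φ v) (fun p => I.weight s(v, N.port v p))
      fun p => φ (N.port v p), fun v => ?_, ?_⟩
    · rw [clusterValue_succ, h1 v, clusterUpdate, Sum.elim_inl, if_pos (by omega)]
      simp only [h1, Sum.elim_inl, id_eq, CorrelationInstance.edgeInput, hL]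
    · rw [colorBits, ← hL]
      by_cases hc : 2 * recolorBits r L ≤ L
      · rw [if_pos hc]
        exact ⟨fun v => recolor_lt (I.weight_port_nonneg N v) (h2 v) (fun p => h2 _) hc,
          fun v => recolor_defect_le I N hL1 hc φ h2 _ (fun _ => rfl) v (h3 v)⟩
      · rw [if_neg hc]
        simp only [recolor, if_neg hc]
        exact ⟨h2, h3⟩

open Classical in
-- When colour `j` decides, the neighbours that broadcast a side are exactly those of colour below
-- `j`, so a node sees which edges to count without remembering their colours.
theorem clusterValue_greedy {r c : ℕ} {φ : V → ℕ}
    (hφ : ∀ v, clusterValue I N r c (logStar (Fintype.card V)) v = Sum.inl (φ v)) (j : ℕ) :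
    ∃ σ : V → Bool, (∀ v, clusterValue I N r c (logStar (Fintype.card V) + j) v =
        if φ v < j then Sum.inr (σ v) else Sum.inl (φ v)) ∧
      ∀ v, φ v < j →
        ∑ p, (if φ (N.port v p) < φ v then I.weight s(v, N.port v p) else 0) ≤
          2 * ∑ p, (if φ (N.port v p) < φ v ∧
            (I.sign s(v, N.port v p)).agreesWith (σ v) (σ (N.port v p))
            then I.weight s(v, N.port v p) else 0) := by
  induction j with
  | zero => exact ⟨fun _ => false, fun v => by simpa using hφ v, fun v hv => by omega⟩
  | succ j ih =>
    obtain ⟨σ, h1, h2⟩ := ih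
    set g : V → Bool := fun v => greedySide (fun p => I.weight s(v, N.port v p))
      (fun p => I.sign s(v, N.port v p))
      fun p => clusterValue I N r c (logStar (Fintype.card V) + j) (N.port v p) with hg
    -- Changing `σ` on class `j` is harmless for earlier classes, whose inequalities involve only
    -- sides of colours below `j`.
    refine ⟨fun v => if φ v = j then g v else σ v, fun v => ?_, fun v hv => ?_⟩
    · rw [← add_assoc, clusterValue_succ, h1 v]
      rcases lt_trichotomy (φ v) j with h | h | h
      · simp [clusterUpdate, h, h.ne, Nat.lt_succ_of_lt h]
      · simp [clusterUpdate, h, hg, CorrelationInstance.edgeInput]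
      · have h' : ¬ φ v < j + 1 := by omega
        simp [clusterUpdate, h.not_gt, h.ne', h']
    · by_cases hvj : φ v = j
      · have hspec : ∑ p, (if (clusterValue I N r c (logStar (Fintype.card V) + j)
            (N.port v p)).isRight then I.weight s(v, N.port v p) else 0) ≤
            2 * ∑ p, (if (clusterValue I N r c (logStar (Fintype.card V) + j)
              (N.port v p)).isRight ∧ (I.sign s(v, N.port v p)).agreesWith (g v)
                ((clusterValue I N r c (logStar (Fintype.card V) + j)
                  (N.port v p)).elim (fun _ => false) id)
              then I.weight s(v, N.port v p) else 0) :=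
          Classical.epsilon_spec (exists_side_agreement (fun p => I.weight s(v, N.port v p))
            (fun p => I.sign s(v, N.port v p)) _ fun p => (clusterValue I N r c
              (logStar (Fintype.card V) + j) (N.port v p)).isRight)
        have hr : ∀ u, (clusterValue I N r c (logStar (Fintype.card V) + j) u).isRight ↔
            φ u < j := by
          intro u
          rw [h1 u]
          split_ifs with h <;> simp [h]
        simp only [hr] at hspec
        rw [hvj]
        refine hspec.trans (mul_le_mul_of_nonneg_left (le_of_eq ?_) zero_le_two)
        refine Finset.sum_congr rfl fun p _ => ?_
        by_cases hp : φ (N.port v p) < j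
        · rw [h1]
          simp [hp, hp.ne, hvj]
        · simp [hp]
      · have hv' : φ v < j := by omega
        refine (h2 v hv').trans (mul_le_mul_of_nonneg_left (le_of_eq ?_) zero_le_two)
        refine Finset.sum_congr rfl fun p _ => ?_
        by_cases hp : φ (N.port v p) < φ v
        · have hpj : φ (N.port v p) ≠ j := by omega
          simp [hp, hpj, hvj]
        · simp [hp]

theorem length_encodeValue_clusterValue_le {r c : ℕ}
    (hN : ∀ v, N.ident v ≤ Fintype.card V ^ c) (t : ℕ) (v : V) :
    (encodeValue (clusterValue I N r c t v)).length ≤ c * Nat.clog 2 (Fintype.card V) + 2 := by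
  rcases le_total t (logStar (Fintype.card V)) with ht | ht
  · obtain ⟨φ, h1, h2, -⟩ := clusterValue_recoloring I N (r := r) hN t ht
    rw [h1 v]
    exact (length_encodeValue_inl_le (h2 v)).trans
      (Nat.succ_le_succ (colorBits_le _ _ _))
  · obtain ⟨φ, h1, h2, -⟩ := clusterValue_recoloring I N (r := r) hN _ le_rfl
    obtain ⟨j, rfl⟩ := Nat.exists_eq_add_of_le ht
    obtain ⟨σ, h3, -⟩ := clusterValue_greedy I N h1 j
    rw [h3 v]
    split_ifs
    · simp [encodeValue]
    · exact (length_encodeValue_inl_le (h2 v)).trans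
        (Nat.succ_le_succ (colorBits_le _ _ _))

theorem clusterValue_isMaxAgreeApprox {r c j : ℕ} (hV : 1 ≤ Fintype.card V)
    (hc : c + 1 ≤ 2 ^ j) (hj : 8 * j + 4 * r + 20 ≤ 2 ^ j)
    (hN : ∀ v, N.ident v ≤ Fintype.card V ^ c) :
    I.IsMaxAgreeApprox ((1 - (1 / 2) ^ r) / 2) (Setoid.ker fun v =>
      ((clusterValue I N r c (logStar (Fintype.card V) + 2 ^ 2 ^ j) v).elim
        (fun _ => false) id).toNat) := by
  obtain ⟨φ, h1, h2, h3⟩ := clusterValue_recoloring I N (r := r) hN _ le_rfl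
  obtain ⟨σ, h4, h5⟩ := clusterValue_greedy I N h1 (2 ^ 2 ^ j)
  have hφ : ∀ v, φ v < 2 ^ 2 ^ j := fun v =>
    (h2 v).trans_le (Nat.pow_le_pow_right two_pos (colorBits_logStar_le hV hc hj))
  have hσ : (fun v => ((clusterValue I N r c (logStar (Fintype.card V) + 2 ^ 2 ^ j) v).elim
        (fun _ => false) id).toNat) = fun v => (σ v).toNat := by
    funext v
    rw [h4 v, if_pos (hφ v)]
    rfl
  rw [hσ]
  refine I.isMaxAgreeApprox_of_greedy N (pow_le_one₀ (by norm_num) (by norm_num)) φ σ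
    (fun v => ?_) fun v => h5 v (hφ v)
  set L := colorBits r (c * Nat.clog 2 (Fintype.card V) + 1) (logStar (Fintype.card V))
  have hL : (1 : ℝ) ≤ L := by exact_mod_cast colorBits_pos (r := r) (by omega) _
  have hm : 0 ≤ ∑ p, (if φ (N.port v p) = φ v then I.weight s(v, N.port v p) else 0) :=
    Finset.sum_nonneg fun p _ => by
      split_ifs
      exacts [I.weight_port_nonneg N v p, le_rfl]
  have h := h3 v
  rw [one_div, inv_pow, ← div_eq_inv_mul, le_div_iff₀ (by positivity), mul_comm]
  refine le_trans ?_ h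
  gcongr
  exact le_mul_of_one_le_right (by positivity) hL

end Execution

/-- For every `ε > 0` and every exponent `c` of the range of identifiers there is a deterministic
algorithm that, on every instance, sends messages of `O(log n)` bits only, terminates after
`O(log* n)` rounds, and lets the nodes output the clusters of a `(1/2 - ε)`-approximation. -/
theorem mainTheorem5 (ε : ℝ) (hε : 0 < ε) (c : ℕ) :
    ∃ (A : CongestAlgorithm (ℝ × EdgeSign) ℕ) (B K : ℝ),
      ∀ (V : Type) [Fintype V] (I : CorrelationInstance V) (N : CongestNetwork I.graph),
        (∀ v, N.ident v ≤ Fintype.card V ^ c) →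
        (∀ (t : ℕ) (v : V) (p : Fin (N.deg v)),
          ((A.message N (A.run N I.edgeInput t) v p).length : ℝ) ≤
            B * Real.logb 2 (Fintype.card V)) ∧
        ∃ (T : ℕ) (cluster : V → ℕ),
          (T : ℝ) ≤ K * logStar (Fintype.card V) ∧
          (∀ v, A.output (A.run N I.edgeInput T v) = some (cluster v)) ∧
          I.IsMaxAgreeApprox (1 / 2 - ε) (Setoid.ker cluster) := by
  -- With `2⁻ʳ < 2 * ε` the ratio `(1 - 2⁻ʳ) / 2` exceeds `1 / 2 - ε`.
  obtain ⟨r, hr⟩ := exists_pow_lt_of_lt_one (show 0 < 2 * ε by linarith)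
    (show (1 / 2 : ℝ) < 1 by norm_num)
  obtain ⟨j, hc, hj⟩ := exists_colorBits_bound r c
  have hdec := Function.leftInverse_invFun encodeValue_injective
  -- For `n ≤ 1` both bounds are zero, so nodes must halt at once. Otherwise final colours have at
  -- most `2 ^ j` bits, giving `2 ^ 2 ^ j` greedy rounds.
  set T : ℕ → ℕ := fun n => if n ≤ 1 then 0 else logStar n + 2 ^ 2 ^ j with hT
  set out : ℕ ⊕ Bool → ℕ := fun x => (x.elim (fun _ => false) id).toNat with hout
  refine ⟨broadcastAlgorithm encodeValue (Function.invFun encodeValue) T Sum.inl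
    (clusterUpdate r c) out, 2 * c + 2, 1 + 2 ^ 2 ^ j, fun V _ I N hN =>
    ⟨fun t v p => ?_, T (Fintype.card V), _, ?_, output_broadcastAlgorithm hdec N _, ?_⟩⟩
  · rw [message_broadcastAlgorithm hdec N _ t v p]
    split_ifs with h
    · have hlog : 0 ≤ Real.logb 2 (Fintype.card V) :=
        div_nonneg (Real.log_natCast_nonneg _) (Real.log_nonneg one_le_two)
      simpa using mul_nonneg (by positivity) hlog
    · have hn : 2 ≤ Fintype.card V := by
        by_contra! h2
        exact h (by simp [hT, Nat.le_of_lt_succ h2])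
      have hlog : 1 ≤ Real.logb 2 (Fintype.card V) := by
        rw [Real.le_logb_iff_rpow_le one_lt_two (by positivity), Real.rpow_one]
        exact_mod_cast hn
      have hclog := Nat.clog_two_le_logb_add_one (m := Fintype.card V) (by omega)
      have hlen : ((encodeValue (clusterValue I N r c t v)).length : ℝ) ≤
          c * Nat.clog 2 (Fintype.card V) + 2 := by
        exact_mod_cast length_encodeValue_clusterValue_le I N hN t v
      refine hlen.trans ?_
      calc (c * Nat.clog 2 (Fintype.card V) + 2 : ℝ)
          ≤ c * (2 * Real.logb 2 (Fintype.card V)) + 2 * Real.logb 2 (Fintype.card V) := by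
            gcongr <;> linarith
        _ = _ := by ring
  · simp only [hT]
    split_ifs with h
    · rw [Nat.cast_zero]
      positivity
    · have h1 : (1 : ℝ) ≤ logStar (Fintype.card V) := by
        exact_mod_cast one_le_logStar (by omega)
      push_cast
      have : (2 : ℝ) ^ 2 ^ j ≤ 2 ^ 2 ^ j * logStar (Fintype.card V) :=
        le_mul_of_one_le_right (by positivity) h1
      linarith
  · by_cases h : Fintype.card V ≤ 1
    · have := Fintype.card_le_one_iff_subsingleton.1 h
      exact I.isMaxAgreeApprox_of_subsingleton _ _
    · have hTV : T (Fintype.card V) = logStar (Fintype.card V) + 2 ^ 2 ^ j := if_neg h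
      rw [hTV]
      exact (clusterValue_isMaxAgreeApprox I N (by omega) hc hj hN).mono (by linarith)
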